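/- All Banach spaces are real, and all constants below take values in $[0,\infty]$, with $\inf\emptyset=\infty$, $\sup\emptyset=0$ and $0\cdot\infty=0$. For a metric space $Y$, a subset $X\subset Y$ with the induced metric, a Banach space $E$ and a Lipschitz map $f\colon X\to E$, let $\operatorname{Lip}(f)$ be the infimum of all $L\ge 0$ such that $f$ is $L$-Lipschitz, and let $e(X,Y,E,f)$ be the infimum of all $K\ge 0$ for which $f$ has a $K\operatorname{Lip}(f)$-Lipschitz extension $\bar f\colon Y\to E$. For a class $\mathcal B$ of Banach spaces put $$\nu_{\mathcal B}(X,Y)=\sup\{e(X,Y,E,f): E\in\mathcal B,\ f\colon X\to E\text{ Lipschitz}\},\qquad \nu_{\mathcal B}(Y)=\sup_{X\subset Y}\nu_{\mathcal B}(X,Y).$$ Write $\nu(X,Y)$ for $\nu_{\mathcal B}(X,Y)$ when $\mathcal B$ is the class of all Banach spaces, $\nu_{\mathrm{fin}}(Y)$ for $\nu_{\mathcal B}(Y)$ when $\mathcal B$ is the class of all finite-dimensional Banach spaces, and $\nu_{\mathrm{dual}}(Y)$ when $\mathcal B$ is the class of all dual Banach spaces, that is, those linearly isometric to the dual of a Banach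 space. For a pointed metric space $(X,p)$ let $\operatorname{Lip}_0(X)$ be the Banach space of all Lipschitz functions $f\colon X\to\mathbb R$ with $f(p)=0$, with the norm $\sup_{x\ne x'}|f(x)-f(x')|/d(x,x')$. For $p\in X\subset Y$ let $\lambda_{\mathrm{Lip}}(X,Y)$ be the infimum of $\|T\|$ over all bounded linear maps $T\colon\operatorname{Lip}_0(X)\to\operatorname{Lip}_0(Y)$ with $(Tf)|_X=f$ for all $f$, both spaces being formed with the base point $p$; this does not depend on $p$. Put $\lambda_{\mathrm{Lip}}(\emptyset,Y)=0$ and $\lambda_{\mathrm{Lip}}(Y)=\sup_{X\subset Y}\lambda_{\mathrm{Lip}}(X,Y)$. **Theorem.** Let $Y$ be a metric space, $X\subset Y$ a subset and $\mathcal B$ a class of Banach spaces. Put $K_{\mathcal B}=\sup\{\nu(E,E^{**}):E\in\mathcal B\}$, where $E$ is regarded as a subset of its bidual $E^{**}$ through the canonical embedding. Then $$\nu_{\mathcal B}(X,Y)\le K_{\mathcal B}\cdot\sup_F\lambda_{\mathrm{Lip}}(F,Y),$$ where the supremum is taken over all finite subsets $F\subset X$. Moreover, if $X$ is nonempty and $\operatorname{Lip}_0(X)^*$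 belongs to $\mathcal B$ (up to linear isometry), then $$\lambda_{\mathrm{Lip}}(X,Y)\le\nu_{\mathcal B}(X,Y).$$ As a consequence, $$\lambda_{\mathrm{Lip}}(Y)=\nu_{\mathrm{dual}}(Y)=\nu_{\mathrm{fin}}(Y).$$ -/

import Mathlib

open scoped NNReal ENNReal

universe u v

noncomputable section

namespace LipExt

/-- `Lip(f)`, the infimum of all `L ≥ 0` for which `f` is `L`-Lipschitz. -/
def lipConst {X : Type u} {E : Type v} [MetricSpace X] [MetricSpace E] (f : X → E) : ℝ≥0 :=
  sInf {L : ℝ≥0 | LipschitzWith L f}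

section Lip0

variable {X : Type u} [MetricSpace X]

/-- The real Lipschitz functions on `X` that vanish at `p`, as a linear subspace of `X → ℝ`. -/
def lip0Submodule (p : X) : Submodule ℝ (X → ℝ) where
  carrier := {f | f p = 0 ∧ ∃ L : ℝ≥0, LipschitzWith L f}
  zero_mem' := ⟨rfl, 0, LipschitzWith.const 0⟩
  add_mem' := by
    rintro f g ⟨hf, K, hK⟩ ⟨hg, L, hL⟩
    exact ⟨by simp [hf, hg], K + L, hK.add hL⟩
  smul_mem' := by
    rintro c f ⟨hf, K, hK⟩
    refine ⟨by simp [hf], ‖c‖₊ * K, ?_⟩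
    refine LipschitzWith.of_dist_le_mul fun x y => ?_
    have h := hK.dist_le_mul x y
    simp only [Pi.smul_apply, smul_eq_mul, Real.dist_eq, NNReal.coe_mul, coe_nnnorm,
      Real.norm_eq_abs] at h ⊢
    rw [← mul_sub, abs_mul, mul_assoc]
    exact mul_le_mul_of_nonneg_left h (abs_nonneg c)

/-- The space `Lip₀(X)` of the pointed metric space `(X, p)`. It is a type of its own, so that it
carries no topology but that of the Lipschitz norm. -/
def Lip0 (p : X) : Type u := lip0Submodule p

variable {p : X}

instance : AddCommGroup (Lip0 p) := inferInstanceAs (AddCommGroup (lip0Submodule p))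

instance : Module ℝ (Lip0 p) := inferInstanceAs (Module ℝ (lip0Submodule p))

instance : CoeFun (Lip0 p) (fun _ => X → ℝ) := ⟨fun f => f.1⟩

/-- The Lipschitz norm `sup_{x ≠ x'} |f x - f x'| / d(x, x')`; the pairs with `x = x'` contribute
`0 / 0 = 0`. -/
instance : Norm (Lip0 p) := ⟨fun f => ⨆ z : X × X, |f z.1 - f z.2| / dist z.1 z.2⟩

theorem Lip0.norm_def (f : Lip0 p) : ‖f‖ = ⨆ z : X × X, |f z.1 - f z.2| / dist z.1 z.2 := rfl

@[ext] theorem Lip0.ext {f g : Lip0 p} (h : ∀ x, f x = g x) : f = g := Subtype.ext (funext h)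

@[simp] theorem Lip0.add_apply (f g : Lip0 p) (x : X) : (f + g) x = f x + g x := rfl

@[simp] theorem Lip0.neg_apply (f : Lip0 p) (x : X) : (-f) x = -f x := rfl

@[simp] theorem Lip0.sub_apply (f g : Lip0 p) (x : X) : (f - g) x = f x - g x := rfl

@[simp] theorem Lip0.smul_apply (c : ℝ) (f : Lip0 p) (x : X) : (c • f) x = c * f x := rfl

@[simp] theorem Lip0.zero_apply (x : X) : (0 : Lip0 p) x = 0 := rfl

@[simp] theorem Lip0.base_apply (f : Lip0 p) : f p = 0 := f.2.1

theorem Lip0.bddAbove (f : Lip0 p) :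
    BddAbove (Set.range fun z : X × X => |f z.1 - f z.2| / dist z.1 z.2) := by
  obtain ⟨-, L, hL⟩ := f.2
  refine ⟨L, ?_⟩
  rintro _ ⟨z, rfl⟩
  exact div_le_of_le_mul₀ dist_nonneg L.2 (hL.dist_le_mul z.1 z.2)

theorem Lip0.abs_sub_le (f : Lip0 p) (x y : X) : |f x - f y| ≤ ‖f‖ * dist x y := by
  rcases eq_or_ne x y with rfl | h
  · simp
  · exact (div_le_iff₀ (dist_pos.2 h)).1 (le_ciSup f.bddAbove (x, y))

theorem Lip0.norm_le (f : Lip0 p) {C : ℝ} (hC : 0 ≤ C)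
    (h : ∀ x y, |f x - f y| ≤ C * dist x y) : ‖f‖ ≤ C :=
  Real.iSup_le (fun z => div_le_of_le_mul₀ dist_nonneg hC (h z.1 z.2)) hC

theorem Lip0.norm_nonneg' (f : Lip0 p) : 0 ≤ ‖f‖ :=
  Real.iSup_nonneg fun _ => div_nonneg (abs_nonneg _) dist_nonneg

theorem Lip0.norm_smul_le' (c : ℝ) (f : Lip0 p) : ‖c • f‖ ≤ |c| * ‖f‖ := by
  refine Lip0.norm_le _ (mul_nonneg (abs_nonneg c) f.norm_nonneg') fun x y => ?_
  rw [Lip0.smul_apply, Lip0.smul_apply, ← mul_sub, abs_mul, mul_assoc]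
  exact mul_le_mul_of_nonneg_left (f.abs_sub_le x y) (abs_nonneg c)

theorem Lip0.normedSpaceCore : NormedSpace.Core ℝ (Lip0 p) where
  norm_nonneg := Lip0.norm_nonneg'
  norm_smul c f := by
    refine le_antisymm (Lip0.norm_smul_le' c f) ?_
    rcases eq_or_ne c 0 with rfl | hc
    · simpa using Lip0.norm_nonneg' ((0 : ℝ) • f)
    · have h := Lip0.norm_smul_le' c⁻¹ (c • f)
      rw [smul_smul, inv_mul_cancel₀ hc, one_smul, abs_inv] at h
      have hc' : 0 < |c| := abs_pos.2 hc
      rw [Real.norm_eq_abs]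
      calc |c| * ‖f‖ ≤ |c| * (|c|⁻¹ * ‖c • f‖) := mul_le_mul_of_nonneg_left h hc'.le
        _ = ‖c • f‖ := by rw [← mul_assoc, mul_inv_cancel₀ hc'.ne', one_mul]
  norm_triangle f g := by
    refine Lip0.norm_le _ (add_nonneg f.norm_nonneg' g.norm_nonneg') fun x y => ?_
    have hf := f.abs_sub_le x y
    have hg := g.abs_sub_le x y
    have h := abs_add_le (f x - f y) (g x - g y)
    have e : (f + g) x - (f + g) y = (f x - f y) + (g x - g y) := by
      simp only [Lip0.add_apply]; ring
    rw [e, add_mul]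
    linarith
  norm_eq_zero_iff f := by
    constructor
    · intro h
      ext x
      have hx := f.abs_sub_le x p
      rw [h, zero_mul, Lip0.base_apply, sub_zero] at hx
      simpa using hx
    · rintro rfl
      exact le_antisymm (Lip0.norm_le _ le_rfl (by simp)) (Lip0.norm_nonneg' _)

instance : NormedAddCommGroup (Lip0 p) := NormedAddCommGroup.ofCore Lip0.normedSpaceCore

instance : NormedSpace ℝ (Lip0 p) := NormedSpace.ofCore Lip0.normedSpaceCore

end Lip0

section Linear

variable {Y : Type u} [MetricSpace Y]

/-- `T` is a linear extension operator for `X ⊆ Y`, with respect to the base point `p ∈ X`. -/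
def IsExtensionOperator (X : Set Y) (p : X) (T : Lip0 p →L[ℝ] Lip0 (p : Y)) : Prop :=
  ∀ (f : Lip0 p) (x : X), T f (x : Y) = f x

/-- `λ_Lip(X, Y)` computed with the base point `p ∈ X` (`∞` if there is no linear extension
operator). -/
def lambdaLipAt (X : Set Y) (p : X) : ℝ≥0∞ :=
  ⨅ (T : Lip0 p →L[ℝ] Lip0 (p : Y)) (_ : IsExtensionOperator X p T), ‖T‖ₑ

/-- `λ_Lip(X, Y)`. The value does not depend on the base point (`lambdaLip_eq`), so the supremum
only removes the choice of one; it is `0` for empty `X`, which has no base point. -/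
def lambdaLip (X : Set Y) : ℝ≥0∞ := ⨆ p : X, lambdaLipAt X p

/-- Change of base point, `f ↦ f - f q`. -/
def Lip0.shift {X : Type u} [MetricSpace X] (p q : X) : Lip0 p →L[ℝ] Lip0 q :=
  LinearMap.mkContinuous
    { toFun := fun f => ⟨fun x => f x - f q, sub_self _, by
        obtain ⟨-, L, hL⟩ := f.2
        exact ⟨L, LipschitzWith.of_dist_le_mul fun x y => by
          simpa [Real.dist_eq] using hL.dist_le_mul x y⟩⟩
      map_add' := fun f g => Lip0.ext fun x => add_sub_add_comm (f x) (g x) (f q) (g q)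
      map_smul' := fun c f => Lip0.ext fun x => (mul_sub c (f x) (f q)).symm }
    1 (fun f => by
      rw [one_mul]
      refine Lip0.norm_le _ f.norm_nonneg' fun x y => ?_
      have e : (f x - f q) - (f y - f q) = f x - f y := by ring
      exact (congrArg abs e).trans_le (f.abs_sub_le x y))

theorem Lip0.shift_apply {X : Type u} [MetricSpace X] (p q : X) (f : Lip0 p) (x : X) :
    Lip0.shift p q f x = f x - f q := rfl

theorem Lip0.norm_shift_le {X : Type u} [MetricSpace X] (p q : X) : ‖Lip0.shift p q‖ ≤ 1 :=
  LinearMap.mkContinuous_norm_le _ zero_le_one _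

theorem lambdaLipAt_le (X : Set Y) (p q : X) : lambdaLipAt X q ≤ lambdaLipAt X p := by
  refine le_iInf₂ fun T hT => ?_
  refine iInf₂_le_of_le
    ((Lip0.shift (p : Y) (q : Y)).comp (T.comp (Lip0.shift q p))) (fun f x => ?_) ?_
  · have h1 := hT (Lip0.shift q p f) x
    have h2 := hT (Lip0.shift q p f) q
    simp only [ContinuousLinearMap.comp_apply]
    rw [Lip0.shift_apply, h1, h2, Lip0.shift_apply, Lip0.shift_apply, Lip0.base_apply]
    ring
  · rw [enorm_le_iff_norm_le]
    calc _ ≤ ‖Lip0.shift (p : Y) (q : Y)‖ * (‖T‖ * ‖Lip0.shift q p‖) :=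
          (ContinuousLinearMap.opNorm_comp_le _ _).trans
            (mul_le_mul_of_nonneg_left (ContinuousLinearMap.opNorm_comp_le _ _) (norm_nonneg _))
      _ ≤ 1 * (‖T‖ * 1) := by
          gcongr
          · exact Lip0.norm_shift_le _ _
          · exact Lip0.norm_shift_le _ _
      _ = ‖T‖ := by ring

theorem lambdaLip_eq (X : Set Y) (p : X) : lambdaLip X = lambdaLipAt X p :=
  le_antisymm (iSup_le fun q => lambdaLipAt_le X p q) (le_iSup (lambdaLipAt X) p)

/-- `λ_Lip(Y)`. -/
def lambdaLipSpace (Y : Type u) [MetricSpace Y] : ℝ≥0∞ := ⨆ X : Set Y, lambdaLip X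

end Linear

section NonLinear

/-- A class of real Banach spaces. -/
def BanachClass : Type (u + 1) :=
  ∀ (E : Type u) [NormedAddCommGroup E] [NormedSpace ℝ E] [CompleteSpace E], Prop

/-- The class of all Banach spaces. -/
def BanachClass.all : BanachClass.{u} := fun _ _ _ _ => True

/-- The class of all finite-dimensional Banach spaces. -/
def BanachClass.fin : BanachClass.{u} := fun E _ _ _ => FiniteDimensional ℝ E

/-- The class of all dual Banach spaces: those linearly isometric to the dual `G*` of a Banach
space `G`. -/
def BanachClass.dual : BanachClass.{u} := fun E _ _ _ =>
  ∃ (G : Type u) (_ : NormedAddCommGroup G) (_ : NormedSpace ℝ G) (_ : CompleteSpace G),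
    Nonempty (E ≃ₗᵢ[ℝ] StrongDual ℝ G)

/-- `V` belongs to `𝓑`, Banach spaces being identified when they are linearly isometric. -/
def BanachClass.Contains (𝓑 : BanachClass.{u}) (V : Type u) [NormedAddCommGroup V]
    [NormedSpace ℝ V] : Prop :=
  ∃ (E : Type u) (_ : NormedAddCommGroup E) (_ : NormedSpace ℝ E) (_ : CompleteSpace E),
    𝓑 E ∧ Nonempty (V ≃ₗᵢ[ℝ] E)

variable {Y : Type u} [MetricSpace Y]

/-- `e(X, Y, E, f)`, the infimum of all `K ≥ 0` such that `f` has a `K Lip(f)`-Lipschitz extension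
to `Y` (`∞` if there is no such `K`). -/
def extConst (X : Set Y) {E : Type v} [MetricSpace E] (f : X → E) : ℝ≥0∞ :=
  ⨅ (K : ℝ≥0) (_ : ∃ g : Y → E, LipschitzWith (K * lipConst f) g ∧ ∀ x : X, g x = f x),
    (K : ℝ≥0∞)

/-- `ν_𝓑(X, Y)`, the supremum of `e(X, Y, E, f)` over all `E ∈ 𝓑` and Lipschitz `f : X → E`. -/
def nuClass (𝓑 : BanachClass.{u}) (X : Set Y) : ℝ≥0∞ :=
  ⨆ (E : Type u) (_ : NormedAddCommGroup E) (_ : NormedSpace ℝ E) (_ : CompleteSpace E)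
    (_ : 𝓑 E) (f : X → E) (_ : ∃ L : ℝ≥0, LipschitzWith L f), extConst X f

/-- `ν(X, Y)`, the supremum of `e(X, Y, E, f)` over all Banach spaces `E` and Lipschitz `f`. -/
def nu (X : Set Y) : ℝ≥0∞ := nuClass BanachClass.all X

/-- `ν_𝓑(Y)`. -/
def nuClassSpace (𝓑 : BanachClass.{u}) (Y : Type u) [MetricSpace Y] : ℝ≥0∞ :=
  ⨆ X : Set Y, nuClass 𝓑 X

/-- `ν(E, E**)`, where `E` is the subset of its bidual given by the canonical embedding. -/
def nuBidual (E : Type u) [NormedAddCommGroup E] [NormedSpace ℝ E] : ℝ≥0∞ :=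
  nu (Set.range (NormedSpace.inclusionInDoubleDual ℝ E))

/-- `K_𝓑 = sup {ν(E, E**) : E ∈ 𝓑}`. -/
def bidualConst (𝓑 : BanachClass.{u}) : ℝ≥0∞ :=
  ⨆ (E : Type u) (_ : NormedAddCommGroup E) (_ : NormedSpace ℝ E) (_ : CompleteSpace E)
    (_ : 𝓑 E), nuBidual E

end NonLinear

end LipExt

end

/-!
Through the pairing `(x, f) ↦ f x`, Lipschitz maps `X → V*` that vanish at `p` correspond to bounded
operators `V → Lip₀(X)`, with the same constants; evaluation `X → Lip₀(X)*` is the map corresponding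
to the identity. So a Lipschitz extension of evaluation to `Y` is a linear extension operator, and
conversely a linear extension operator extends every Lipschitz map with values in a dual space.

Banach-Alaoglu glues extensions of a dual-valued map from the finite subsets of `X`. A map into a
general `E` is first extended with values in the dual space `E**`, and then composed with an
extension to `E**` of the inverse of the canonical embedding `E → E**`.
-/

namespace LipExt

open Filter Topology
open NormedSpace (inclusionInDoubleDual inclusionInDoubleDualLi)

namespace Lip0

variable {X : Type u} [MetricSpace X]

/-- Evaluation `δ : X → Lip₀(X)*`, the canonical embedding of `X` into the dual of `Lip₀(X)`. -/
noncomputable def eval (p x : X) : StrongDual ℝ (Lip0 p) :=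
  LinearMap.mkContinuous
    { toFun := fun f => f x
      map_add' := fun _ _ => rfl
      map_smul' := fun _ _ => rfl }
    (dist x p) (fun f => by
      have h := f.abs_sub_le x p
      rwa [base_apply, sub_zero, mul_comm] at h)

@[simp] theorem eval_apply {p : X} (x : X) (f : Lip0 p) : eval p x f = f x := rfl

theorem lipschitzWith_eval (p : X) : LipschitzWith 1 (eval p) :=
  LipschitzWith.of_dist_le_mul fun x y => by
    rw [dist_eq_norm, NNReal.coe_one, one_mul]
    refine ContinuousLinearMap.opNorm_le_bound _ dist_nonneg fun f => ?_
    simpa [mul_comm] using f.abs_sub_le x y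

variable {V : Type v} [NormedAddCommGroup V] [NormedSpace ℝ V]

theorem lipschitzWith_eval_comp {p : X} (T : V →L[ℝ] Lip0 p) :
    LipschitzWith ‖T‖₊ fun x => (eval p x).comp T :=
  LipschitzWith.of_dist_le_mul fun x y => by
    have hδ : ‖eval p x - eval p y‖ ≤ dist x y := by
      simpa [dist_eq_norm] using (lipschitzWith_eval p).dist_le_mul x y
    rw [dist_eq_norm, ← ContinuousLinearMap.sub_comp, coe_nnnorm, mul_comm]
    exact (ContinuousLinearMap.opNorm_comp_le _ _).trans
      (mul_le_mul_of_nonneg_right hδ (norm_nonneg T))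

section Flip

variable {C : ℝ≥0} {g : X → StrongDual ℝ V}

theorem abs_apply_sub_apply_le (hg : LipschitzWith C g) (v : V) (x y : X) :
    |g x v - g y v| ≤ C * ‖v‖ * dist x y :=
  calc |g x v - g y v| ≤ ‖g x - g y‖ * ‖v‖ := (g x - g y).le_opNorm v
    _ ≤ C * dist x y * ‖v‖ := by
        gcongr
        simpa [dist_eq_norm] using hg.dist_le_mul x y
    _ = C * ‖v‖ * dist x y := mul_right_comm _ _ _

/-- The operator `v ↦ (x ↦ g x v - g p v)` from `V` to `Lip₀(X)` obtained from a Lipschitz map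
`g : X → V*` by exchanging its arguments; the constant `g p v` makes it vanish at `p`. -/
noncomputable def flip (p : X) (hg : LipschitzWith C g) : V →L[ℝ] Lip0 p :=
  LinearMap.mkContinuous
    { toFun := fun v => ⟨fun x => g x v - g p v, sub_self _, C * ‖v‖₊,
        LipschitzWith.of_dist_le_mul fun x y => by
          simpa [Real.dist_eq] using abs_apply_sub_apply_le hg v x y⟩
      map_add' := fun v w => Lip0.ext fun x => map_add (g x - g p) v w
      map_smul' := fun c v => Lip0.ext fun x => map_smul (g x - g p) c v }
    C (fun v => Lip0.norm_le _ (by positivity) fun x y =>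
      (congrArg abs (sub_sub_sub_cancel_right _ _ _)).trans_le (abs_apply_sub_apply_le hg v x y))

@[simp] theorem flip_apply (p : X) (hg : LipschitzWith C g) (v : V) (x : X) :
    flip p hg v x = g x v - g p v := rfl

theorem nnnorm_flip_le (p : X) (hg : LipschitzWith C g) : ‖flip p hg‖₊ ≤ C :=
  LinearMap.mkContinuous_norm_le _ C.2 _

end Flip

variable {p : X}

theorem exists_clm_apply_eq_comp_sub {g : X → V} {C : ℝ≥0} (hg : LipschitzWith C g) :
    ∃ R : StrongDual ℝ V →L[ℝ] Lip0 p, ∀ ξ x, R ξ x = ξ (g x) - ξ (g p) :=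
  ⟨flip p ((inclusionInDoubleDualLi ℝ).lipschitz.comp hg), fun _ _ => rfl⟩

/- `Lip₀(X)` is a retract of its bidual, through `ξ ↦ (x ↦ ξ (eval p x))`, hence closed in it. -/
instance : CompleteSpace (Lip0 p) := by
  let ι : Lip0 p →ₗᵢ[ℝ] StrongDual ℝ (StrongDual ℝ (Lip0 p)) := inclusionInDoubleDualLi ℝ
  obtain ⟨R, hR⟩ := exists_clm_apply_eq_comp_sub (lipschitzWith_eval p)
  have hRι : Function.LeftInverse R ι := fun f => Lip0.ext fun x =>
    calc R (ι f) x = f x - f p := hR (ι f) x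
      _ = f x := by rw [base_apply, sub_zero]
  have hclosed : IsClosed (Set.range ι) :=
    (hRι.isClosedEmbedding R.continuous ι.continuous).isClosed_range
  exact (completeSpace_iff_isComplete_range ι.isometry.isUniformInducing).2 hclosed.isComplete

instance [Finite X] : FiniteDimensional ℝ (Lip0 p) :=
  inferInstanceAs (FiniteDimensional ℝ (lip0Submodule p))

end Lip0

section LipConst

variable {X : Type u} {E : Type v} [MetricSpace X] [MetricSpace E] {f : X → E}

theorem lipConst_le {L : ℝ≥0} (hf : LipschitzWith L f) : lipConst f ≤ L :=
  csInf_le' hf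

theorem lipschitzWith_lipConst (hf : ∃ L : ℝ≥0, LipschitzWith L f) :
    LipschitzWith (lipConst f) f := by
  refine LipschitzWith.of_dist_le_mul fun x y => ?_
  suffices nndist (f x) (f y) ≤ lipConst f * nndist x y from mod_cast this
  rcases eq_or_ne x y with rfl | hxy
  · simp
  · have hd : 0 < nndist x y := pos_iff_ne_zero.2 (nndist_eq_zero.not.2 hxy)
    rw [← div_le_iff₀ hd]
    exact le_csInf hf fun L hL => (div_le_iff₀ hd).2 (hL.nndist_le x y)

theorem lipConst_isometry_comp {Z : Type*} [MetricSpace Z] {ι : E → Z} (hι : Isometry ι) :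
    lipConst (ι ∘ f) = lipConst f := by
  simp only [lipConst, hι.lipschitzWith_iff]

end LipConst

section ExtConst

variable {Y : Type u} [MetricSpace Y] {X : Set Y} {E : Type v} [MetricSpace E] {f : X → E}

theorem extConst_le {K : ℝ≥0} {g : Y → E} (hg : LipschitzWith (K * lipConst f) g)
    (hgf : ∀ x : X, g x = f x) : extConst X f ≤ K :=
  iInf₂_le K ⟨g, hg, hgf⟩

theorem exists_extension_of_extConst_lt {c : ℝ≥0} (h : extConst X f < c) :
    ∃ g : Y → E, LipschitzWith (c * lipConst f) g ∧ ∀ x : X, g x = f x := by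
  simp only [extConst, iInf_lt_iff] at h
  obtain ⟨K, ⟨g, hg, hgf⟩, hK⟩ := h
  exact ⟨g, hg.weaken (mul_le_mul_left (ENNReal.coe_lt_coe.1 hK).le _), hgf⟩

theorem extConst_eq_zero_of_forall_eq [Nonempty E] (hf : ∀ x y, f x = f y) :
    extConst X f = 0 := by
  obtain ⟨c, hc⟩ : ∃ c, ∀ x, c = f x := by
    rcases isEmpty_or_nonempty X with hX | ⟨⟨p⟩⟩
    · exact ⟨Classical.arbitrary E, hX.elim⟩
    · exact ⟨f p, hf p⟩
  refine le_antisymm (extConst_le (g := fun _ => c) ?_ hc) zero_le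
  simp

theorem one_le_extConst {x y : X} (hxy : f x ≠ f y) : 1 ≤ extConst X f := by
  refine le_iInf₂ fun K ⟨g, hg, hgf⟩ => ?_
  have hf : LipschitzWith (K * lipConst f) f := by
    have h := hg.comp (LipschitzWith.subtype_val X)
    rwa [mul_one, show g ∘ Subtype.val = f from funext hgf] at h
  have hpos : 0 < lipConst f := pos_iff_ne_zero.2 fun h0 =>
    hxy ((LipschitzWith.zero_iff f).1 (by simpa [h0] using hf) x y)
  exact_mod_cast (le_mul_iff_one_le_left hpos).1 (lipConst_le hf)

theorem extConst_isometryEquiv_comp {Z : Type*} [MetricSpace Z] (e : E ≃ᵢ Z) :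
    extConst X (e ∘ f) = extConst X f := by
  simp only [extConst, lipConst_isometry_comp e.isometry]
  refine iInf_congr fun K => iInf_congr_Prop ⟨?_, ?_⟩ fun _ => rfl
  · rintro ⟨g, hg, hgf⟩
    exact ⟨e.symm ∘ g, (e.symm.isometry.lipschitzWith_iff _).2 hg, fun x => by simp [hgf]⟩
  · rintro ⟨g, hg, hgf⟩
    exact ⟨e ∘ g, (e.isometry.lipschitzWith_iff _).2 hg, fun x => by simp [hgf]⟩

theorem extConst_le_extConst_range_mul [Nonempty E] {Z : Type*} [MetricSpace Z] {ι : E → Z}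
    (hι : Isometry ι) :
    extConst X f ≤ extConst (Set.range ι) hι.isometryEquivOnRange.symm * extConst X (ι ∘ f) := by
  by_cases hconst : ∀ x y, f x = f y
  · simp [extConst_eq_zero_of_forall_eq hconst]
  push Not at hconst
  obtain ⟨x, y, hxy⟩ := hconst
  set i := hι.isometryEquivOnRange
  have hr_one : 1 ≤ extConst (Set.range ι) i.symm :=
    one_le_extConst (x := i (f x)) (y := i (f y)) (by simpa using hxy)
  have hg_one : 1 ≤ extConst X (ι ∘ f) := one_le_extConst (hι.injective.ne hxy)
  refine ENNReal.le_mul_of_forall_lt (.inl (one_pos.trans_le hr_one).ne')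
    (.inr (one_pos.trans_le hg_one).ne') fun k' hk' l' hl' => ?_
  obtain ⟨k, hk, hkk'⟩ := ENNReal.lt_iff_exists_nnreal_btwn.1 hk'
  obtain ⟨l, hl, hll'⟩ := ENNReal.lt_iff_exists_nnreal_btwn.1 hl'
  obtain ⟨r, hr, hri⟩ := exists_extension_of_extConst_lt hk
  obtain ⟨g, hg, hgf⟩ := exists_extension_of_extConst_lt hl
  have hr' : LipschitzWith k r :=
    hr.weaken (mul_le_of_le_one_right' (lipConst_le i.symm.isometry.lipschitz))
  have hrg : LipschitzWith (k * l * lipConst f) (r ∘ g) := by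
    simpa only [lipConst_isometry_comp hι, mul_assoc] using hr'.comp hg
  have hrgf : ∀ z : X, (r ∘ g) z = f z := fun z => by
    simpa [hgf, i.symm_apply_apply] using! hri (i (f z))
  calc extConst X f ≤ (k * l : ℝ≥0) := extConst_le hrg hrgf
    _ ≤ k' * l' := by
        rw [ENNReal.coe_mul]
        exact mul_le_mul' hkk'.le hll'.le

end ExtConst

section NuClass

variable {Y : Type u} [MetricSpace Y] {X : Set Y} {𝓑 : BanachClass.{u}}
  {E : Type u} [NormedAddCommGroup E] [NormedSpace ℝ E] [CompleteSpace E]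

theorem extConst_le_nuClass (hE : 𝓑 E) {f : X → E} (hf : ∃ L : ℝ≥0, LipschitzWith L f) :
    extConst X f ≤ nuClass 𝓑 X :=
  le_iSup_of_le E <| le_iSup_of_le inferInstance <| le_iSup_of_le inferInstance <|
    le_iSup_of_le inferInstance <| le_iSup_of_le hE <| le_iSup_of_le f <| le_iSup_of_le hf le_rfl

theorem nuClass_le {c : ℝ≥0∞}
    (h : ∀ (E : Type u) [NormedAddCommGroup E] [NormedSpace ℝ E] [CompleteSpace E], 𝓑 E →
      ∀ f : X → E, (∃ L : ℝ≥0, LipschitzWith L f) → extConst X f ≤ c) : nuClass 𝓑 X ≤ c :=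
  iSup_le fun E => iSup_le fun _ => iSup_le fun _ => iSup_le fun _ => iSup_le fun hE =>
    iSup_le fun f => iSup_le fun hf => h E hE f hf

theorem nuClass_mono {𝓐 : BanachClass.{u}}
    (h : ∀ (E : Type u) [NormedAddCommGroup E] [NormedSpace ℝ E] [CompleteSpace E], 𝓐 E → 𝓑 E) :
    nuClass 𝓐 X ≤ nuClass 𝓑 X :=
  nuClass_le fun E _ _ _ hE _ hf => extConst_le_nuClass (h E hE) hf

theorem nuBidual_le_bidualConst (hE : 𝓑 E) : nuBidual E ≤ bidualConst 𝓑 :=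
  le_iSup_of_le E <| le_iSup_of_le inferInstance <| le_iSup_of_le inferInstance <|
    le_iSup_of_le inferInstance <| le_iSup_of_le hE le_rfl

theorem BanachClass.Contains.of_mem (hE : 𝓑 E) : 𝓑.Contains E :=
  ⟨E, inferInstance, inferInstance, inferInstance, hE, ⟨.refl ℝ E⟩⟩

theorem BanachClass.dual_strongDual (G : Type u) [NormedAddCommGroup G] [NormedSpace ℝ G]
    [CompleteSpace G] : BanachClass.dual (StrongDual ℝ G) :=
  ⟨G, inferInstance, inferInstance, inferInstance, ⟨.refl ℝ _⟩⟩

theorem BanachClass.dual_of_fin (hE : BanachClass.fin E) : BanachClass.dual E := by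
  have : FiniteDimensional ℝ E := hE
  have finrank_eq_dual (V : Type u) [NormedAddCommGroup V] [NormedSpace ℝ V]
      [FiniteDimensional ℝ V] : Module.finrank ℝ V = Module.finrank ℝ (StrongDual ℝ V) :=
    Subspace.dual_finrank_eq.symm.trans (LinearMap.toContinuousLinearMap (E := V)).finrank_eq
  exact ⟨StrongDual ℝ E, inferInstance, inferInstance, inferInstance,
    ⟨(inclusionInDoubleDualLi ℝ).toLinearIsometryEquiv
      ((finrank_eq_dual E).trans (finrank_eq_dual _))⟩⟩

end NuClass

section Compactness

variable {α 𝕜 G : Type*} [NontriviallyNormedField 𝕜] [ProperSpace 𝕜]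
  [SeminormedAddCommGroup G] [NormedSpace 𝕜 G]

theorem exists_tendsto_apply_of_eventually_norm_le (U : Ultrafilter α) {φ : α → StrongDual 𝕜 G}
    {R : ℝ} (hφ : ∀ᶠ s in (U : Filter α), ‖φ s‖ ≤ R) :
    ∃ ψ : StrongDual 𝕜 G, ∀ v, Tendsto (fun s => φ s v) U (𝓝 (ψ v)) := by
  obtain ⟨ψ, -, hψ⟩ := (WeakDual.isCompact_closedBall (𝕜 := 𝕜) (0 : StrongDual 𝕜 G) R)
    |>.ultrafilter_le_nhds (U.map fun s => StrongDual.toWeakDual (φ s))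
      (le_principal_iff.2 (hφ.mono fun s hs => mem_closedBall_zero_iff.2 hs))
  exact ⟨WeakDual.toStrongDual ψ, fun v => ((WeakDual.eval_continuous v).tendsto ψ).comp hψ⟩

theorem exists_lipschitzWith_tendsto_apply {Y : Type*} [PseudoMetricSpace Y] (U : Ultrafilter α)
    {M : ℝ≥0} {g : α → Y → StrongDual 𝕜 G} (hg : ∀ s, LipschitzWith M (g s)) {p : Y} {R : ℝ}
    (hp : ∀ᶠ s in (U : Filter α), ‖g s p‖ ≤ R) :
    ∃ g' : Y → StrongDual 𝕜 G, LipschitzWith M g' ∧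
      ∀ y v, Tendsto (fun s => g s y v) U (𝓝 (g' y v)) := by
  have hbdd (y : Y) : ∀ᶠ s in (U : Filter α), ‖g s y‖ ≤ M * dist y p + R := by
    filter_upwards [hp] with s hs
    calc ‖g s y‖ ≤ ‖g s y - g s p‖ + ‖g s p‖ := norm_le_norm_sub_add _ _
      _ ≤ M * dist y p + R := by
          gcongr
          simpa [dist_eq_norm] using (hg s).dist_le_mul y p
  choose g' hg' using fun y => exists_tendsto_apply_of_eventually_norm_le U (hbdd y)
  refine ⟨g', LipschitzWith.of_dist_le_mul fun y z => ?_, hg'⟩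
  rw [dist_eq_norm]
  refine ContinuousLinearMap.opNorm_le_bound _ (by positivity) fun v => ?_
  refine le_of_tendsto ((hg' y v).sub (hg' z v)).norm (Eventually.of_forall fun s => ?_)
  calc ‖g s y v - g s z v‖ ≤ ‖g s y - g s z‖ * ‖v‖ := (g s y - g s z).le_opNorm v
    _ ≤ M * dist y z * ‖v‖ := by
        gcongr
        simpa [dist_eq_norm] using (hg s).dist_le_mul y z

theorem exists_extension_of_forall_finset {Y : Type*} [PseudoMetricSpace Y] {X : Set Y}
    {f : X → StrongDual 𝕜 G} {M : ℝ≥0}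
    (hfin : ∀ s : Finset X, ∃ g : Y → StrongDual 𝕜 G, LipschitzWith M g ∧ ∀ x ∈ s, g x = f x) :
    ∃ g : Y → StrongDual 𝕜 G, LipschitzWith M g ∧ ∀ x : X, g x = f x := by
  rcases isEmpty_or_nonempty X with hX | ⟨⟨p⟩⟩
  · exact ⟨fun _ => 0, LipschitzWith.const' 0, hX.elim⟩
  choose g hg hgf using hfin
  let U : Ultrafilter (Finset X) := Ultrafilter.of atTop
  have heq (x : X) : ∀ᶠ s in (U : Filter (Finset X)), g s x = f x :=
    Ultrafilter.of_le atTop ((eventually_ge_atTop {x}).mono fun s hs =>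
      hgf s x (Finset.singleton_subset_iff.1 hs))
  obtain ⟨g', hg', hlim⟩ := exists_lipschitzWith_tendsto_apply U hg
    ((heq p).mono fun s hs => (congrArg norm hs).le)
  refine ⟨g', hg', fun x => ContinuousLinearMap.ext fun v => ?_⟩
  exact tendsto_nhds_unique (hlim x v)
    (tendsto_const_nhds.congr' ((heq x).mono fun s hs => (DFunLike.congr_fun hs v).symm))

end Compactness

section LambdaLip

variable {Y : Type u} [MetricSpace Y] {X : Set Y}

theorem lambdaLipAt_le_extConst_eval (p : X) : lambdaLipAt X p ≤ extConst X (Lip0.eval p) := by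
  refine le_iInf₂ fun K ⟨g, hg, hgδ⟩ => ?_
  have hgK : LipschitzWith K g :=
    hg.weaken (mul_le_of_le_one_right' (lipConst_le (Lip0.lipschitzWith_eval p)))
  have hT : IsExtensionOperator X p (Lip0.flip (p : Y) hgK) := fun f x => by simp [hgδ]
  exact (iInf₂_le _ hT).trans (ENNReal.coe_le_coe.2 (Lip0.nnnorm_flip_le _ hgK))

theorem lambdaLipAt_le_nuClass {𝓑 : BanachClass.{u}} {p : X}
    (h : 𝓑.Contains (StrongDual ℝ (Lip0 p))) : lambdaLipAt X p ≤ nuClass 𝓑 X := by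
  obtain ⟨E, _, _, _, hE, ⟨e⟩⟩ := h
  have hδ : LipschitzWith (1 * 1) (e ∘ Lip0.eval p) :=
    e.lipschitz.comp (Lip0.lipschitzWith_eval p)
  calc lambdaLipAt X p ≤ extConst X (Lip0.eval p) := lambdaLipAt_le_extConst_eval p
    _ = extConst X (e ∘ Lip0.eval p) := (extConst_isometryEquiv_comp e.toIsometryEquiv).symm
    _ ≤ nuClass 𝓑 X := extConst_le_nuClass hE ⟨_, hδ⟩

theorem lambdaLip_le_nuClass {𝓑 : BanachClass.{u}}
    (h : ∀ p : X, 𝓑.Contains (StrongDual ℝ (Lip0 p))) : lambdaLip X ≤ nuClass 𝓑 X :=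
  iSup_le fun p => lambdaLipAt_le_nuClass (h p)

theorem lambdaLip_le_nuClass_dual : lambdaLip X ≤ nuClass BanachClass.dual X :=
  lambdaLip_le_nuClass fun p => .of_mem (BanachClass.dual_strongDual (Lip0 p))

theorem lambdaLip_le_nuClass_fin (hX : X.Finite) : lambdaLip X ≤ nuClass BanachClass.fin X := by
  have := hX.to_subtype
  have hfin (p : X) : BanachClass.fin (StrongDual ℝ (Lip0 p)) :=
    inferInstanceAs (FiniteDimensional ℝ (StrongDual ℝ (Lip0 p)))
  exact lambdaLip_le_nuClass fun p => .of_mem (hfin p)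

variable {V : Type v} [NormedAddCommGroup V] [NormedSpace ℝ V] {f : X → StrongDual ℝ V} {c C : ℝ≥0}

theorem IsExtensionOperator.exists_extension {p : X} {T : Lip0 p →L[ℝ] Lip0 (p : Y)}
    (hT : IsExtensionOperator X p T) (hf : LipschitzWith C f) :
    ∃ g : Y → StrongDual ℝ V, LipschitzWith (‖T‖₊ * C) g ∧ ∀ x : X, g x = f x := by
  let S : V →L[ℝ] Lip0 (p : Y) := T.comp (Lip0.flip p hf)
  have hS : ‖S‖₊ ≤ ‖T‖₊ * C :=
    (T.opNNNorm_comp_le _).trans (mul_le_mul_right (Lip0.nnnorm_flip_le p hf) _)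
  refine ⟨fun y => (Lip0.eval (p : Y) y).comp S + f p, ?_, fun x => ?_⟩
  · simpa using ((Lip0.lipschitzWith_eval_comp S).weaken hS).add (LipschitzWith.const (f p))
  · ext v
    simp [S, hT (Lip0.flip p hf v) x]

theorem exists_extension_of_lambdaLip_lt (h : lambdaLip X < c) (hf : LipschitzWith C f) :
    ∃ g : Y → StrongDual ℝ V, LipschitzWith (c * C) g ∧ ∀ x : X, g x = f x := by
  rcases isEmpty_or_nonempty X with hX | ⟨⟨p⟩⟩
  · exact ⟨fun _ => 0, LipschitzWith.const' 0, hX.elim⟩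
  have hp : lambdaLipAt X p < c := (le_iSup (lambdaLipAt X) p).trans_lt h
  simp only [lambdaLipAt, iInf_lt_iff] at hp
  obtain ⟨T, hT, hTc⟩ := hp
  obtain ⟨g, hg, hgf⟩ := hT.exists_extension hf
  exact ⟨g, hg.weaken (mul_le_mul_left (ENNReal.coe_lt_coe.1 hTc).le C), hgf⟩

/-- `sup_F λ_Lip(F, Y)` over all finite subsets `F` of `X`, the constant that controls extension
from `X` by compactness. -/
noncomputable def lambdaLipFinite (X : Set Y) : ℝ≥0∞ :=
  ⨆ (F : Set Y) (_ : F ⊆ X) (_ : F.Finite), lambdaLip F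

theorem exists_extension_of_lambdaLipFinite_lt (h : lambdaLipFinite X < c)
    (hf : LipschitzWith C f) :
    ∃ g : Y → StrongDual ℝ V, LipschitzWith (c * C) g ∧ ∀ x : X, g x = f x := by
  refine exists_extension_of_forall_finset fun s => ?_
  let F : Set Y := Subtype.val '' (s : Set X)
  have hFX : F ⊆ X := Subtype.coe_image_subset X s
  have hF : lambdaLip F ≤ lambdaLipFinite X :=
    le_iSup_of_le F <| le_iSup₂_of_le hFX (s.finite_toSet.image _) le_rfl
  have hfF : LipschitzWith C (f ∘ Set.inclusion hFX) := fun x y =>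
    hf (Set.inclusion hFX x) (Set.inclusion hFX y)
  obtain ⟨g, hg, hgf⟩ := exists_extension_of_lambdaLip_lt (hF.trans_lt h) hfF
  exact ⟨g, hg, fun x hx => hgf ⟨x, x, hx, rfl⟩⟩

theorem extConst_le_lambdaLipFinite (hf : ∃ L : ℝ≥0, LipschitzWith L f) :
    extConst X f ≤ lambdaLipFinite X := by
  refine le_of_forall_gt_imp_ge_of_dense fun c' hc' => ?_
  obtain ⟨c, hc, hcc'⟩ := ENNReal.lt_iff_exists_nnreal_btwn.1 hc'
  obtain ⟨g, hg, hgf⟩ := exists_extension_of_lambdaLipFinite_lt hc (lipschitzWith_lipConst hf)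
  exact (extConst_le hg hgf).trans hcc'.le

theorem nuClass_dual_le_lambdaLipFinite : nuClass BanachClass.dual X ≤ lambdaLipFinite X := by
  refine nuClass_le fun E _ _ _ hE f hf => ?_
  obtain ⟨G, _, _, _, ⟨e⟩⟩ := hE
  obtain ⟨L, hL⟩ := hf
  rw [← extConst_isometryEquiv_comp e.toIsometryEquiv]
  exact extConst_le_lambdaLipFinite ⟨_, e.lipschitz.comp hL⟩

theorem nuClass_le_bidualConst_mul_lambdaLipFinite (X : Set Y) (𝓑 : BanachClass.{u}) :
    nuClass 𝓑 X ≤ bidualConst 𝓑 * lambdaLipFinite X := by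
  refine nuClass_le fun E _ _ _ hE f ⟨L, hL⟩ => ?_
  have hι : Isometry (inclusionInDoubleDual ℝ E) := (inclusionInDoubleDualLi ℝ).isometry
  have hinv : extConst _ hι.isometryEquivOnRange.symm ≤ bidualConst 𝓑 :=
    (extConst_le_nuClass (𝓑 := BanachClass.all) trivial
      ⟨1, hι.isometryEquivOnRange.symm.isometry.lipschitz⟩).trans (nuBidual_le_bidualConst hE)
  have hbidual : extConst X (inclusionInDoubleDual ℝ E ∘ f) ≤ lambdaLipFinite X :=
    extConst_le_lambdaLipFinite ⟨_, hι.lipschitz.comp hL⟩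
  exact (extConst_le_extConst_range_mul hι).trans (mul_le_mul' hinv hbidual)

end LambdaLip

section Space

variable {Y : Type u} [MetricSpace Y]

theorem lambdaLipFinite_le_of_forall_finite {X : Set Y} {c : ℝ≥0∞}
    (h : ∀ F : Set Y, F.Finite → lambdaLip F ≤ c) : lambdaLipFinite X ≤ c :=
  iSup_le fun F => iSup₂_le fun _ hF => h F hF

theorem nuClassSpace_dual_le {c : ℝ≥0∞} (h : ∀ F : Set Y, F.Finite → lambdaLip F ≤ c) :
    nuClassSpace BanachClass.dual Y ≤ c :=
  iSup_le fun _ => nuClass_dual_le_lambdaLipFinite.trans (lambdaLipFinite_le_of_forall_finite h)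

end Space

end LipExt

theorem theorem1p2 {Y : Type u} [MetricSpace Y] :
    (∀ (X : Set Y) (𝓑 : LipExt.BanachClass.{u}),
      LipExt.nuClass 𝓑 X ≤
        LipExt.bidualConst 𝓑 *
          ⨆ (F : Set Y) (_ : F ⊆ X) (_ : F.Finite), LipExt.lambdaLip F) ∧
    (∀ (X : Set Y) (𝓑 : LipExt.BanachClass.{u}) (p : X),
      𝓑.Contains (StrongDual ℝ (LipExt.Lip0 p)) →
        LipExt.lambdaLip X ≤ LipExt.nuClass 𝓑 X) ∧
    LipExt.lambdaLipSpace Y = LipExt.nuClassSpace LipExt.BanachClass.dual Y ∧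
    LipExt.nuClassSpace LipExt.BanachClass.dual Y =
      LipExt.nuClassSpace LipExt.BanachClass.fin Y := by
  refine ⟨LipExt.nuClass_le_bidualConst_mul_lambdaLipFinite, fun X 𝓑 p h => ?_,
    le_antisymm ?_ ?_, le_antisymm ?_ ?_⟩
  · exact (LipExt.lambdaLip_eq X p).trans_le (LipExt.lambdaLipAt_le_nuClass h)
  · exact iSup_mono fun _ => LipExt.lambdaLip_le_nuClass_dual
  · exact LipExt.nuClassSpace_dual_le fun F _ => le_iSup LipExt.lambdaLip F
  · exact LipExt.nuClassSpace_dual_le fun F hF =>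
      (LipExt.lambdaLip_le_nuClass_fin hF).trans (le_iSup (LipExt.nuClass _) F)
  · exact iSup_mono fun _ => LipExt.nuClass_mono fun _ _ _ _ => LipExt.BanachClass.dual_of_fin
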